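/- Let $G$ be a compact (Hausdorff) group with Haar measure $dr$. Let $\lambda_s$ and $\rho_r$ be the left and right regular representations on $L^2(G)$, $(\lambda_s f)(t)=f(s^{-1}t)$ and $(\rho_r f)(s)=f(sr)$. Let $\mathcal T(G)$ denote the predual of $\mathcal B(L^2(G))$, that is, the norm closed linear span of the functionals $T\mapsto (T\xi,\eta)$, $\xi,\eta\in L^2(G)$, in the dual of $\mathcal B(L^2(G))$, with the pairing $\langle T,h\rangle=h(T)$; the weak-* topology of $\mathcal B(L^2(G))$ is the one given by this pairing. For $f\in L^1(G)$ let $\theta(f):\mathcal T(G)\to\mathcal T(G)$ be the map determined by $$\langle T,\theta(f)h\rangle=\int_G \langle \rho_r T\rho_r^*,h\rangle f(r)\,dr,\qquad T\in\mathcal B(L^2(G)),\ h\in\mathcal T(G).$$ Let $\mathrm{VN}(G)$ be the weak-* closed linear span of $\{\lambda_s : s\in G\}$ in $\mathcal B(L^2(G))$, and for $a\in L^\infty(G)$ let $M_a$ be the operator of multiplication by $a$ on $L^2(G)$. Theorem. Let $J\subseteq L^1(G)$ be a closed left ideal of the convolution algebra $L^1(G)$. Put $$J^\perp=\Big\{a\in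 L^\infty(G): \int_G f a=0 \text{ for all } f\in J\Big\},\qquad \mathrm{Ran}\,J=\overline{\mathrm{span}}^{\|\cdot\|}\{\theta(f)h: f\in J,\ h\in\mathcal T(G)\}\subseteq\mathcal T(G),$$ $$(\mathrm{Ran}\,J)^\perp=\{T\in\mathcal B(L^2(G)):\langle T,h\rangle=0\text{ for all }h\in \mathrm{Ran}\,J\},$$ $$\mathrm{Bim}(J^\perp)=\overline{\mathrm{span}}^{w^*}\{A M_a B: A,B\in \mathrm{VN}(G),\ a\in J^\perp\}\subseteq\mathcal B(L^2(G)).$$ Then $$(\mathrm{Ran}\,J)^\perp=\mathrm{Bim}(J^\perp).$$ -/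

import Mathlib

open MeasureTheory
open scoped ENNReal InnerProductSpace

noncomputable section

namespace LeftIdealBimodule

/-! ### Closed linear spans as Banach spaces -/

section ClosedSpan

variable {E : Type*} [NormedAddCommGroup E] [NormedSpace ℂ E]

/-- The norm closed linear span of a subset of a normed space, as a normed space of its own. -/
def ClosedSpan (s : Set E) : Type _ := (Submodule.span ℂ s).topologicalClosure

namespace ClosedSpan

variable (s : Set E)

instance instNormedAddCommGroup : NormedAddCommGroup (ClosedSpan s) :=
  inferInstanceAs (NormedAddCommGroup (Submodule.span ℂ s).topologicalClosure)

instance instNormedSpace : NormedSpace ℂ (ClosedSpan s) :=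
  inferInstanceAs (NormedSpace ℂ (Submodule.span ℂ s).topologicalClosure)

instance instCompleteSpace [CompleteSpace E] : CompleteSpace (ClosedSpan s) :=
  inferInstanceAs (CompleteSpace (Submodule.span ℂ s).topologicalClosure)

/-- The inclusion of the closed span of `s` into the ambient space. -/
def incl : ClosedSpan s →L[ℂ] E := (Submodule.span ℂ s).topologicalClosure.subtypeL

theorem norm_incl (h : ClosedSpan s) : ‖incl s h‖ = ‖h‖ := rfl

theorem range_incl : Set.range (incl s) = closure (Submodule.span ℂ s : Set E) := by
  rw [← Submodule.topologicalClosure_coe]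
  exact Subtype.range_coe

variable {s}

theorem map_mem (L : E →L[ℂ] E) (hL : Set.MapsTo L s s) (h : ClosedSpan s) :
    L (incl s h) ∈ (Submodule.span ℂ s).topologicalClosure := by
  have hs : Set.MapsTo L (Submodule.span ℂ s) (Submodule.span ℂ s) := by
    intro x hx
    have hle : Submodule.span ℂ s ≤ (Submodule.span ℂ s).comap (L : E →ₗ[ℂ] E) :=
      Submodule.span_le.2 fun y hy => Submodule.subset_span (hL hy)
    exact hle hx
  exact hs.closure L.continuous h.2

/-- The restriction to the closed span of `s` of a bounded operator that maps `s` into itself. -/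
def restrict (L : E →L[ℂ] E) (hL : Set.MapsTo L s s) : ClosedSpan s →L[ℂ] ClosedSpan s :=
  (L.comp (incl s)).codRestrict (Submodule.span ℂ s).topologicalClosure (map_mem L hL)

@[simp]
theorem incl_restrict (L : E →L[ℂ] E) (hL : Set.MapsTo L s s) (h : ClosedSpan s) :
    incl s (restrict L hL h) = L (incl s h) := rfl

end ClosedSpan

end ClosedSpan

/-- The closure of a subspace of `V` in the weak topology `σ(V, W)` of a pairing of `V` and `W`. -/
def weakClosure {V W : Type*} [AddCommGroup V] [Module ℂ V] [AddCommGroup W] [Module ℂ W]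
    (B : V →ₗ[ℂ] W →ₗ[ℂ] ℂ) (S : Submodule ℂ V) : Submodule ℂ V :=
  letI : TopologicalSpace V := WeakBilin.instTopologicalSpace B
  haveI : ContinuousAdd V := WeakBilin.instContinuousAdd B
  haveI : ContinuousSMul ℂ V := WeakBilin.instContinuousSMul B
  S.topologicalClosure

theorem mem_weakClosure_iff {V W : Type*} [AddCommGroup V] [Module ℂ V] [AddCommGroup W]
    [Module ℂ W] (B : V →ₗ[ℂ] W →ₗ[ℂ] ℂ) (S : Submodule ℂ V) (x : V) :
    x ∈ weakClosure B S ↔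
      (fun w => B x w) ∈ closure ((fun (v : V) (w : W) => B v w) '' (S : Set V)) :=
  @closure_induced V (W → ℂ) Pi.topologicalSpace (fun v w => B v w) x S

/-! ### The predual of the algebra of bounded operators and its weak-* topology -/

section Operators

variable (H : Type*) [NormedAddCommGroup H] [InnerProductSpace ℂ H]

variable {H} in
/-- The vector functional `T ↦ (T ξ, η)`; the inner product of Mathlib is linear in its second
argument. It corresponds to the elementary kernel `h(x, y) = ξ(x) * conj η(y)` when `H = L²(G)`. -/
def vectorFunctional (ξ η : H) : StrongDual ℂ (H →L[ℂ] H) :=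
  (innerSL ℂ η).comp (ContinuousLinearMap.apply ℂ H ξ)

variable {H} in
@[simp]
theorem vectorFunctional_apply (ξ η : H) (T : H →L[ℂ] H) :
    vectorFunctional ξ η T = ⟪η, T ξ⟫_ℂ := rfl

/-- The predual `𝓣(H)` of `𝓑(H)` (the trace class), realised isometrically inside the dual of
`𝓑(H)` as the norm closed span of the vector functionals. Its norm, the trace norm, is the norm of
the functional. -/
abbrev TraceClass : Type _ :=
  ClosedSpan {ω : StrongDual ℂ (H →L[ℂ] H) | ∃ ξ η : H, ω = vectorFunctional ξ η}

variable {H} in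
/-- An element of `𝓣(H)` as a functional on `𝓑(H)`. -/
abbrev TraceClass.toDual (h : TraceClass H) : StrongDual ℂ (H →L[ℂ] H) := ClosedSpan.incl _ h

/-- The duality pairing `(T, h) ↦ ⟨T, h⟩` between `𝓑(H)` and `𝓣(H)`: evaluation of the
functional `h` at `T`. -/
def pairing : (H →L[ℂ] H) →ₗ[ℂ] TraceClass H →ₗ[ℂ] ℂ :=
  LinearMap.mk₂ ℂ (fun T h => TraceClass.toDual h T)
    (fun T S h => map_add (TraceClass.toDual h) T S)
    (fun c T h => map_smul (TraceClass.toDual h) c T)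
    (fun T h k => by
      simp only [TraceClass.toDual]
      rw [map_add]
      rfl)
    (fun c T h => by
      simp only [TraceClass.toDual]
      rw [map_smul]
      rfl)

variable {H} in
@[simp]
theorem pairing_apply (T : H →L[ℂ] H) (h : TraceClass H) :
    pairing H T h = TraceClass.toDual h T := rfl

variable {H} in
/-- The closure of a subspace of `𝓑(H)` in the weak-* topology `σ(𝓑(H), 𝓣(H))`. -/
def weakStarClosure (S : Submodule ℂ (H →L[ℂ] H)) : Submodule ℂ (H →L[ℂ] H) :=
  weakClosure (pairing H) S

variable {H} in
/-- The annihilator in `𝓑(H)` of a subspace of `𝓣(H)`. -/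
def operatorAnnihilator (R : Submodule ℂ (TraceClass H)) : Submodule ℂ (H →L[ℂ] H) where
  carrier := {T | ∀ h ∈ R, pairing H T h = 0}
  add_mem' hT hS h hh := by
    rw [map_add, LinearMap.add_apply, hT h hh, hS h hh, add_zero]
  zero_mem' h _ := by rw [map_zero, LinearMap.zero_apply]
  smul_mem' c T hT h hh := by
    rw [map_smul, LinearMap.smul_apply, hT h hh, smul_zero]

variable [CompleteSpace H]

variable {H} in
theorem mapsTo_ad (U : H →L[ℂ] H) :
    Set.MapsTo ((ContinuousLinearMap.compL ℂ (H →L[ℂ] H) (H →L[ℂ] H) ℂ).flip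
        (ContinuousLinearMap.mulLeftRight ℂ (H →L[ℂ] H) U (star U)))
      {ω : StrongDual ℂ (H →L[ℂ] H) | ∃ ξ η : H, ω = vectorFunctional ξ η}
      {ω : StrongDual ℂ (H →L[ℂ] H) | ∃ ξ η : H, ω = vectorFunctional ξ η} := by
  rintro _ ⟨ξ, η, rfl⟩
  refine ⟨star U ξ, star U η, ?_⟩
  ext T
  simp [ContinuousLinearMap.star_eq_adjoint, ContinuousLinearMap.adjoint_inner_left]

variable {H} in
/-- The predual of the map `T ↦ U T U*` on `𝓑(H)`. -/
def adPredual (U : H →L[ℂ] H) : TraceClass H →L[ℂ] TraceClass H :=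
  ClosedSpan.restrict _ (mapsTo_ad U)

variable {H} in
theorem pairing_adPredual (U T : H →L[ℂ] H) (h : TraceClass H) :
    pairing H T (adPredual U h) = pairing H (U * T * star U) h := rfl

end Operators

/-! ### Translations, convolution and multiplication operators on a compact group -/

section Group

variable {G : Type*} [Group G] [TopologicalSpace G] [IsTopologicalGroup G] [CompactSpace G]
  [MeasurableSpace G] [BorelSpace G] (μ : Measure G) [μ.IsHaarMeasure]

/-- A compact group is unimodular: its left Haar measure is right invariant. -/
theorem measurePreserving_mul_right_of_compact (r : G) :
    MeasurePreserving (fun s : G => s * r) μ μ := by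
  refine ⟨measurable_mul_const r, ?_⟩
  have h := Measure.isMulInvariant_eq_smul_of_compactSpace (μ.map (fun s : G => s * r)) μ
  have h1 := congrArg (fun ν : Measure G => ν Set.univ) h
  simp only [Measure.map_apply (measurable_mul_const r) MeasurableSet.univ, Set.preimage_univ,
    Measure.smul_apply] at h1
  have h0 : μ Set.univ ≠ 0 := NeZero.ne _
  have ht : μ Set.univ ≠ ∞ := measure_ne_top _ _
  have hc : Measure.haarScalarFactor (μ.map (fun s : G => s * r)) μ = 1 := by
    rw [ENNReal.smul_def, smul_eq_mul] at h1
    have := (ENNReal.mul_eq_right h0 ht).1 h1.symm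
    exact_mod_cast this
  rw [h, hc, one_smul]

/-- Left translation on `Lᵖ(G)`: `(λ_s f)(t) = f(s⁻¹ t)`. -/
def leftTranslation (p : ℝ≥0∞) [Fact (1 ≤ p)] (s : G) : Lp ℂ p μ →L[ℂ] Lp ℂ p μ :=
  (Lp.compMeasurePreservingₗᵢ ℂ (fun t : G => s⁻¹ * t)
    (measurePreserving_mul_left μ s⁻¹)).toContinuousLinearMap

/-- The left regular representation `λ` of `G` on `L²(G)`. -/
abbrev leftRegular (s : G) : Lp ℂ 2 μ →L[ℂ] Lp ℂ 2 μ := leftTranslation μ 2 s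

/-- The right regular representation of `G` on `L²(G)`: `(ρ_r f)(s) = f(s r)`; the modular
function of a compact group is `1`. -/
def rightRegular (r : G) : Lp ℂ 2 μ →L[ℂ] Lp ℂ 2 μ :=
  (Lp.compMeasurePreservingₗᵢ ℂ (fun s : G => s * r)
    (measurePreserving_mul_right_of_compact μ r)).toContinuousLinearMap

/-- The convolution `(g * f)(x) = ∫ g(y) f(y⁻¹ x) dy` on `L¹(G)`, as the `L¹(G)`-valued
integral `g * f = ∫ g(y) λ_y f dy`. -/
def convolution (g f : Lp ℂ 1 μ) : Lp ℂ 1 μ :=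
  ∫ y, g y • leftTranslation μ 1 y f ∂μ

variable {μ} in
/-- `J` is a left ideal of the convolution algebra `L¹(G)`. -/
def IsLeftIdeal (J : Submodule ℂ (Lp ℂ 1 μ)) : Prop :=
  ∀ g f : Lp ℂ 1 μ, f ∈ J → convolution μ g f ∈ J

variable {μ} in
/-- The annihilator of `J ⊆ L¹(G)` in `L^∞(G)` for the bilinear pairing `∫ f a`. -/
def annihilator (J : Submodule ℂ (Lp ℂ 1 μ)) : Set (Lp ℂ ∞ μ) :=
  {a | ∀ f ∈ J, ∫ x, f x * a x ∂μ = 0}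

variable {μ} in
/-- The operator `M_a` on `L²(G)` of multiplication by `a ∈ L^∞(G)`. -/
def multiplicationOperator (a : Lp ℂ ∞ μ) : Lp ℂ 2 μ →L[ℂ] Lp ℂ 2 μ :=
  (ContinuousLinearMap.mul ℂ ℂ).holderL μ ∞ 2 2 a

/-- The group von Neumann algebra `VN(G)`: the weak-* closed span of the operators `λ_s`. -/
def groupVN : Submodule ℂ (Lp ℂ 2 μ →L[ℂ] Lp ℂ 2 μ) :=
  weakStarClosure (Submodule.span ℂ (Set.range (leftRegular μ)))

variable {μ} in
/-- `Bim(𝓤)`: the weak-* closed `VN(G)`-bimodule generated by `{M_a : a ∈ 𝓤}`. -/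
def Bim (𝓤 : Set (Lp ℂ ∞ μ)) : Submodule ℂ (Lp ℂ 2 μ →L[ℂ] Lp ℂ 2 μ) :=
  weakStarClosure (Submodule.span ℂ
    {T | ∃ A ∈ groupVN μ, ∃ B ∈ groupVN μ, ∃ a ∈ 𝓤, T = A * multiplicationOperator a * B})

/-- The predual `θ_r` of the map `T ↦ ρ_r T ρ_r*` on `𝓑(L²(G))`. -/
def thetaPoint (r : G) : TraceClass (Lp ℂ 2 μ) →L[ℂ] TraceClass (Lp ℂ 2 μ) :=
  adPredual (rightRegular μ r)

variable {μ} in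
/-- `θ(f)(h) = ∫ f(r) θ_r(h) dr`, the predual of the map `Θ(f)` on `𝓑(L²(G))` that is given by
`⟨Θ(f)(T), h⟩ = ∫ ⟨ρ_r T ρ_r*, h⟩ f(r) dr`. -/
def theta (f : Lp ℂ 1 μ) (h : TraceClass (Lp ℂ 2 μ)) : TraceClass (Lp ℂ 2 μ) :=
  ∫ r, f r • thetaPoint μ r h ∂μ

variable {μ} in
/-- `Ran J`: the norm closed span in `𝓣(G)` of the elements `θ(f)(h)`, `f ∈ J`, `h ∈ 𝓣(G)`. -/
def Ran (J : Submodule ℂ (Lp ℂ 1 μ)) : Submodule ℂ (TraceClass (Lp ℂ 2 μ)) :=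
  (Submodule.span ℂ {k | ∃ f ∈ J, ∃ h, k = theta f h}).topologicalClosure

end Group

end LeftIdealBimodule

end

/-!
The annihilator of `Ran J` consists of the operators `T` with `∫ f(r) ⟨ρ_r T ρ_r*, h⟩ dr = 0` for
all `f ∈ J` and all `h` in the predual.

*The bimodule is contained in it.* The commutant of the right translations is weak-* closed and
contains every `λ_s`, so it contains `VN(G)`; this reduces the claim to `T = M_a` with `a ∈ J^⊥`.
On the vector functional of continuous `ξ, η` the integral is the pairing of `a` with an average
of right translates of `φ = conj η * ξ` with weight `f`. Substituting in the convolution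
(`convolution_toLp`) identifies this average with `φ * f`, which lies in the left ideal `J`.

*It is contained in the bimodule.* By the bipolar theorem (`mem_weakClosure_iff_forall`) it
suffices that an element `h` of the predual which kills all `A M_a B` also kills `T`. For a
continuous function `g` let `λ(g) = ∫ g(s) λ_s ds`. The operator `λ(g')* T λ(g)` has a continuous
kernel, and sorting that kernel by the value `s` of `x y⁻¹` gives
`λ(g')* T λ(g) = ∫ M_{a_s} λ_s ds`, with the coefficient functions
`a_s(x) = (ρ_x T ρ_x* ρ_s g, g')` (`star_leftConvolution_mul_mul_leftConvolution`). That `T`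
annihilates `Ran J`, tested on vector functionals, says exactly that every `a_s` is in `J^⊥`
(`coefficient_mem_annihilator`), so `h` kills `λ(g')* T λ(g)` for all continuous `g, g'`. Both
`s ↦ ⟨λ_s* S, h⟩` and `s ↦ ⟨S λ_s, h⟩` are continuous for every operator `S`, and a continuous
function orthogonal to all continuous functions vanishes, in particular at the identity; used on
either side this gives `⟨T, h⟩ = 0`.

The group is not assumed to be second countable, so multiplication need not be measurable for the
product of the Borel σ-algebras. All vector-valued integrands are therefore continuous functions on
the compact group, possibly times a scalar density, and the order of integration is exchanged only
for continuous functions. Density of the continuous functions in `L¹` and `L²` rests on the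
regularity of Haar measure on a compact group.
-/

open scoped ENNReal InnerProductSpace

noncomputable section

namespace LeftIdealBimodule

/-! ### Annihilators and weak closures -/

section Bipolar

variable {V W : Type*} [AddCommGroup V] [Module ℂ V] [AddCommGroup W] [Module ℂ W]

/-- The bipolar theorem for subspaces: the weak closure of `S` is cut out by the functionals
coming from `W` that vanish on `S`. -/
theorem mem_weakClosure_iff_forall (B : V →ₗ[ℂ] W →ₗ[ℂ] ℂ) (S : Submodule ℂ V) (x : V) :
    x ∈ weakClosure B S ↔ ∀ w, (∀ v ∈ S, B v w = 0) → B x w = 0 := by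
  constructor
  · intro hx w hw
    rw [mem_weakClosure_iff] at hx
    have hcl : IsClosed {φ : W → ℂ | φ w = 0} := isClosed_singleton.preimage (continuous_apply w)
    refine closure_minimal ?_ hcl hx
    rintro _ ⟨v, hv, rfl⟩
    exact hw v hv
  · intro h
    by_contra hx
    let _ : TopologicalSpace V := WeakBilin.instTopologicalSpace B
    have : IsTopologicalAddGroup V := WeakBilin.instIsTopologicalAddGroup B
    have : ContinuousSMul ℂ V := WeakBilin.instContinuousSMul B
    have : LocallyConvexSpace ℝ V := WeakBilin.locallyConvexSpace (𝕜 := ℂ) (B := B)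
    obtain ⟨f, u, hfu, hux⟩ := RCLike.geometric_hahn_banach_closed_point (𝕜 := ℂ)
      (S.topologicalClosure.restrictScalars ℝ).convex S.isClosed_topologicalClosure hx
    obtain ⟨w, rfl⟩ := LinearMap.dualEmbedding_surjective B f
    have hre : ∀ v ∈ S.topologicalClosure, RCLike.re (B v w) < u := hfu
    have hu : 0 < u := by simpa using hre 0 S.topologicalClosure.zero_mem
    have h0 : ∀ v ∈ S, B v w = 0 := by
      intro v hv
      by_contra hne
      -- scaling `v` moves the real part of `B v w` to `u`, which is out of reach on `S`
      have hmem : ((u : ℂ) * (B v w)⁻¹) • v ∈ S.topologicalClosure :=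
        Submodule.smul_mem _ _ (S.le_topologicalClosure hv)
      have h1 : RCLike.re (B (((u : ℂ) * (B v w)⁻¹) • v) w) < u := hre _ hmem
      rw [map_smul, LinearMap.smul_apply, smul_eq_mul, mul_assoc, inv_mul_cancel₀ hne,
        mul_one] at h1
      simp at h1
    have h2 : u < RCLike.re (B x w) := hux
    rw [h w h0, map_zero] at h2
    exact lt_asymm hu h2

end Bipolar

section ClosedSpan

variable {E : Type*} [NormedAddCommGroup E] [NormedSpace ℂ E]

/-- A closed subspace of a closed span that contains the generators is everything. -/
theorem ClosedSpan.eq_top_of_generators {s : Set E} (K : Submodule ℂ (ClosedSpan s))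
    (hK : IsClosed (K : Set (ClosedSpan s)))
    (hs : ∀ h : ClosedSpan s, ClosedSpan.incl s h ∈ s → h ∈ K) : K = ⊤ := by
  have hspan : ∀ x (hx : x ∈ Submodule.span ℂ s), ∀ h : ClosedSpan s,
      ClosedSpan.incl s h = x → h ∈ K := by
    intro x hx
    have hle : Submodule.span ℂ s ≤ K.map (ClosedSpan.incl s : ClosedSpan s →ₗ[ℂ] E) := by
      refine Submodule.span_le.2 fun y hy => ?_
      exact ⟨⟨y, Submodule.le_topologicalClosure _ (Submodule.subset_span hy)⟩, hs _ hy, rfl⟩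
    intro h hh
    obtain ⟨k, hk, hkx⟩ := hle hx
    have : h = k := Subtype.ext (hh.trans hkx.symm)
    rwa [this]
  refine eq_top_iff.2 fun h _ => ?_
  have hh : (ClosedSpan.incl s h) ∈ closure (Submodule.span ℂ s : Set E) := h.2
  rw [Metric.mem_closure_iff] at hh
  refine hK.closure_subset (Metric.mem_closure_iff.2 fun ε hε => ?_)
  obtain ⟨b, hb, hd⟩ := hh ε hε
  exact ⟨⟨b, Submodule.le_topologicalClosure _ hb⟩, hspan b hb _ rfl, hd⟩

end ClosedSpan

/-! ### Strongly continuous families of operators and their integrals -/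

section Integrable

variable {X F : Type*} [TopologicalSpace X] [CompactSpace X] [MeasurableSpace X] [BorelSpace X]
  {μ : Measure X} [NormedAddCommGroup F]

theorem integrable_of_continuous [IsFiniteMeasure μ] {f : X → F} (hf : Continuous f) :
    Integrable f μ :=
  hf.integrable_of_hasCompactSupport (HasCompactSupport.of_compactSpace f)

theorem integrable_smul_of_continuous [NormedSpace ℂ F] {f : X → ℂ} (hf : Integrable f μ)
    {v : X → F} (hv : Continuous v) : Integrable (fun x => f x • v x) μ := by
  obtain ⟨C, hC⟩ := (isCompact_range hv).isBounded.exists_norm_le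
  exact hf.smul_bdd C hv.aestronglyMeasurable_of_compactSpace (.of_forall fun x => hC _ ⟨x, rfl⟩)

end Integrable

section Strong

variable {X : Type*} [TopologicalSpace X]
variable {E F : Type*} [NormedAddCommGroup E] [NormedSpace ℂ E]
  [NormedAddCommGroup F] [NormedSpace ℂ F]

/-- The subspace of the vectors on which a family of operators is pointwise continuous. -/
def continuityDomain (Φ : X → E →L[ℂ] F) : Submodule ℂ E where
  carrier := {e | Continuous fun x => Φ x e}
  add_mem' ha hb := by
    simp only [Set.mem_ofPred_eq, map_add] at *
    exact ha.add hb
  zero_mem' := by simpa using continuous_const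
  smul_mem' c e he := by
    simp only [Set.mem_ofPred_eq, map_smul] at *
    exact he.const_smul c

/-- When `e` is a limit of vectors of the domain, the uniform bound makes `x ↦ Φ x e` a uniform limit
of continuous functions. -/
theorem isClosed_continuityDomain (Φ : X → E →L[ℂ] F) {C : ℝ} (hC : ∀ x, ‖Φ x‖ ≤ C) :
    IsClosed (continuityDomain Φ : Set E) := by
  refine isClosed_of_closure_subset fun e he => ?_
  refine continuous_of_uniform_approx_of_continuous fun u hu => ?_
  obtain ⟨ε, hε, hεu⟩ := Metric.mem_uniformity_dist.1 hu
  have hpos : 0 < max C 0 + 1 := by positivity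
  obtain ⟨b, hb, hd⟩ := Metric.mem_closure_iff.1 he (ε / (max C 0 + 1)) (by positivity)
  refine ⟨fun x => Φ x b, hb, fun x => hεu ?_⟩
  rw [dist_eq_norm, ← map_sub]
  rw [dist_eq_norm, lt_div_iff₀ hpos] at hd
  calc ‖Φ x (e - b)‖ ≤ ‖Φ x‖ * ‖e - b‖ := (Φ x).le_opNorm _
    _ ≤ (max C 0 + 1) * ‖e - b‖ := by
        gcongr
        exact (hC x).trans ((le_max_left _ _).trans (by linarith))
    _ < ε := by rwa [mul_comm]

/-- By the Banach–Steinhaus theorem a strongly continuous family over a compact space is bounded. -/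
theorem exists_norm_le_of_strongly_continuous [CompactSpace X] [CompleteSpace E]
    {Φ : X → E →L[ℂ] F} (hΦ : ∀ e, Continuous fun x => Φ x e) : ∃ C, ∀ x, ‖Φ x‖ ≤ C := by
  refine banach_steinhaus fun e => ?_
  obtain ⟨C, hC⟩ := (isCompact_range (hΦ e)).isBounded.exists_norm_le
  exact ⟨C, fun x => hC _ ⟨x, rfl⟩⟩

variable [CompactSpace X] [MeasurableSpace X] [BorelSpace X] (μ : Measure X)

/-- The weighted integral in the strong operator topology, `e ↦ ∫ f x • Φ x e dμ(x)`, of a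
strongly continuous family of operators. -/
def strongIntegral [CompleteSpace E] {f : X → ℂ} (hf : Integrable f μ) {Φ : X → E →L[ℂ] F}
    (hΦ : ∀ e, Continuous fun x => Φ x e) : E →L[ℂ] F :=
  LinearMap.mkContinuousOfExistsBound
    { toFun := fun e => ∫ x, f x • Φ x e ∂μ
      map_add' := fun a b => by
        simp only [map_add, smul_add]
        exact integral_add (integrable_smul_of_continuous hf (hΦ a))
          (integrable_smul_of_continuous hf (hΦ b))
      map_smul' := fun c a => by
        simp only [map_smul, RingHom.id_apply, smul_comm _ c]
        exact integral_smul c _ }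
    (by
      obtain ⟨C, hC⟩ := exists_norm_le_of_strongly_continuous hΦ
      refine ⟨(∫ x, ‖f x‖ ∂μ) * C, fun e => ?_⟩
      rw [mul_assoc, ← integral_mul_const]
      refine norm_integral_le_of_norm_le (hf.norm.mul_const _) (.of_forall fun x => ?_)
      rw [norm_smul]
      exact mul_le_mul_of_nonneg_left ((Φ x).le_of_opNorm_le (hC x) e) (norm_nonneg _))

theorem strongIntegral_apply [CompleteSpace E] {f : X → ℂ} (hf : Integrable f μ)
    {Φ : X → E →L[ℂ] F} (hΦ : ∀ e, Continuous fun x => Φ x e) (e : E) :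
    strongIntegral μ hf hΦ e = ∫ x, f x • Φ x e ∂μ := rfl

theorem clm_comp_strongIntegral [CompleteSpace E] [CompleteSpace F] {F' : Type*}
    [NormedAddCommGroup F'] [NormedSpace ℂ F'] [CompleteSpace F'] (T : F →L[ℂ] F') {f : X → ℂ}
    (hf : Integrable f μ) {Φ : X → E →L[ℂ] F} (hΦ : ∀ e, Continuous fun x => Φ x e) :
    T.comp (strongIntegral μ hf hΦ) =
      strongIntegral μ hf (Φ := fun x => T.comp (Φ x)) (fun e => T.continuous.comp (hΦ e)) := by
  refine ContinuousLinearMap.ext fun e => ?_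
  have h := ContinuousLinearMap.integral_comp_comm T (integrable_smul_of_continuous hf (hΦ e))
  simp only [map_smul] at h
  exact h.symm

theorem inner_strongIntegral_right [CompleteSpace E] {H : Type*} [NormedAddCommGroup H]
    [InnerProductSpace ℂ H] [CompleteSpace H] {f : X → ℂ} (hf : Integrable f μ)
    {Φ : X → E →L[ℂ] H} (hΦ : ∀ e, Continuous fun x => Φ x e) (w : H) (e : E) :
    ⟪w, strongIntegral μ hf hΦ e⟫_ℂ = ∫ x, f x * ⟪w, Φ x e⟫_ℂ ∂μ := by
  rw [strongIntegral_apply, ← integral_inner (integrable_smul_of_continuous hf (hΦ e))]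
  simp only [inner_smul_right]

theorem inner_strongIntegral_left [CompleteSpace E] {H : Type*} [NormedAddCommGroup H]
    [InnerProductSpace ℂ H] [CompleteSpace H] {f : X → ℂ} (hf : Integrable f μ)
    {Φ : X → E →L[ℂ] H} (hΦ : ∀ e, Continuous fun x => Φ x e) (w : H) (e : E) :
    ⟪strongIntegral μ hf hΦ e, w⟫_ℂ = ∫ x, star (f x) * ⟪Φ x e, w⟫_ℂ ∂μ := by
  rw [← inner_conj_symm, inner_strongIntegral_right, ← integral_conj]
  simp only [map_mul, inner_conj_symm, RCLike.star_def]

/-- Integration of a fixed continuous function against densities in `L¹`, `f ↦ ∫ f v dμ`. -/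
def weightedIntegral (v : X → F) (hv : Continuous v) : Lp ℂ 1 μ →L[ℂ] F :=
  LinearMap.mkContinuousOfExistsBound
    { toFun := fun f => ∫ x, f x • v x ∂μ
      map_add' := fun f g => by
        rw [← integral_add (integrable_smul_of_continuous (L1.integrable_coeFn f) hv)
          (integrable_smul_of_continuous (L1.integrable_coeFn g) hv)]
        refine integral_congr_ae ?_
        filter_upwards [Lp.coeFn_add f g] with x hx
        rw [hx, Pi.add_apply, add_smul]
      map_smul' := fun c f => by
        rw [RingHom.id_apply, ← integral_smul]
        refine integral_congr_ae ?_
        filter_upwards [Lp.coeFn_smul c f] with x hx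
        rw [hx, Pi.smul_apply, smul_assoc] }
    (by
      obtain ⟨C, hC⟩ := (isCompact_range hv).isBounded.exists_norm_le
      refine ⟨C, fun f => ?_⟩
      rw [L1.norm_eq_integral_norm, ← integral_const_mul]
      refine norm_integral_le_of_norm_le ((L1.integrable_coeFn f).norm.const_mul C)
        (.of_forall fun x => ?_)
      rw [norm_smul, mul_comm]
      exact mul_le_mul_of_nonneg_right (hC _ ⟨x, rfl⟩) (norm_nonneg _))

theorem weightedIntegral_apply (v : X → F) (hv : Continuous v) (f : Lp ℂ 1 μ) :
    weightedIntegral μ v hv f = ∫ x, f x • v x ∂μ := rfl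

end Strong

/-! ### Vector functionals and the predual -/

section Predual

variable {H : Type*} [NormedAddCommGroup H] [InnerProductSpace ℂ H]

/-- The vector functional `T ↦ (T ξ, η)` as an element of the predual. -/
def traceVector (ξ η : H) : TraceClass H :=
  ⟨vectorFunctional ξ η, Submodule.le_topologicalClosure _ (Submodule.subset_span ⟨ξ, η, rfl⟩)⟩

@[simp]
theorem pairing_traceVector (T : H →L[ℂ] H) (ξ η : H) :
    pairing H T (traceVector ξ η) = ⟪η, T ξ⟫_ℂ := rfl

theorem continuous_traceVector : Continuous fun p : H × H => traceVector p.1 p.2 := by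
  refine Continuous.subtype_mk ?_ _
  have h1 : Continuous fun p : H × H => ContinuousLinearMap.apply ℂ H p.1 :=
    (ContinuousLinearMap.apply ℂ H).continuous.comp continuous_fst
  have h2 : Continuous fun p : H × H => innerSL ℂ p.2 :=
    (innerSL ℂ (E := H)).continuous.comp continuous_snd
  exact h2.clm_comp h1

/-- A closed subspace of the predual that contains the vector functionals is everything. -/
theorem eq_top_of_traceVector_mem (K : Submodule ℂ (TraceClass H))
    (hK : IsClosed (K : Set (TraceClass H))) (h : ∀ ξ η, traceVector ξ η ∈ K) : K = ⊤ := by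
  refine ClosedSpan.eq_top_of_generators K hK ?_
  rintro k ⟨ξ, η, hk⟩
  have : k = traceVector ξ η := Subtype.ext hk
  rw [this]
  exact h ξ η

/-- Bounded operators on the predual into a normed space are determined by the vector
functionals. -/
theorem traceClass_hom_ext {F : Type*} [NormedAddCommGroup F] [NormedSpace ℂ F]
    {L M : TraceClass H →L[ℂ] F} (h : ∀ ξ η, L (traceVector ξ η) = M (traceVector ξ η)) :
    L = M := by
  have : LinearMap.eqLocus (L : TraceClass H →ₗ[ℂ] F) (M : TraceClass H →ₗ[ℂ] F) = ⊤ :=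
    eq_top_of_traceVector_mem _ (isClosed_eq L.continuous M.continuous) h
  ext k
  have hk : k ∈ LinearMap.eqLocus (L : TraceClass H →ₗ[ℂ] F) (M : TraceClass H →ₗ[ℂ] F) :=
    this ▸ Submodule.mem_top
  exact hk

/-- The functional `h ↦ ⟨T, h⟩` on the predual. -/
def pairingCLM (T : H →L[ℂ] H) : TraceClass H →L[ℂ] ℂ :=
  (ContinuousLinearMap.apply ℂ ℂ T).comp (ClosedSpan.incl _)

theorem norm_pairingCLM_le (T : H →L[ℂ] H) : ‖pairingCLM T‖ ≤ ‖T‖ := by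
  refine ContinuousLinearMap.opNorm_le_bound _ (norm_nonneg _) fun h => ?_
  rw [mul_comm]
  exact (TraceClass.toDual h).le_opNorm T

/-- A uniformly bounded family of operators on the predual is strongly continuous as soon as it
is continuous on vector functionals. -/
theorem continuous_of_continuous_traceVector {X F : Type*} [TopologicalSpace X]
    [NormedAddCommGroup F] [NormedSpace ℂ F] {Φ : X → TraceClass H →L[ℂ] F} {C : ℝ}
    (hC : ∀ x, ‖Φ x‖ ≤ C) (hΦ : ∀ ξ η, Continuous fun x => Φ x (traceVector ξ η))
    (h : TraceClass H) : Continuous fun x => Φ x h := by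
  have h1 : continuityDomain Φ = ⊤ :=
    eq_top_of_traceVector_mem _ (isClosed_continuityDomain Φ hC) hΦ
  have h2 : h ∈ continuityDomain Φ := h1 ▸ Submodule.mem_top
  exact h2

variable [CompleteSpace H] {X : Type*} [TopologicalSpace X] [CompactSpace X]

theorem continuous_pairing {Φ : X → H →L[ℂ] H} (hΦ : ∀ ξ, Continuous fun x => Φ x ξ)
    (h : TraceClass H) : Continuous fun x => pairing H (Φ x) h := by
  obtain ⟨C, hC⟩ := exists_norm_le_of_strongly_continuous hΦ
  exact continuous_of_continuous_traceVector (Φ := fun x => pairingCLM (Φ x))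
    (fun x => (norm_pairingCLM_le _).trans (hC x)) (fun ξ η => continuous_const.inner (hΦ ξ)) h

/-- Elements of the predual commute with integrals in the strong operator topology. -/
theorem pairing_strongIntegral [MeasurableSpace X] [BorelSpace X] (μ : Measure X)
    {f : X → ℂ} (hf : Integrable f μ) {Φ : X → H →L[ℂ] H}
    (hΦ : ∀ ξ, Continuous fun x => Φ x ξ) (h : TraceClass H) :
    pairing H (strongIntegral μ hf hΦ) h = ∫ x, f x * pairing H (Φ x) h ∂μ := by
  have hc : ∀ h, Continuous fun x => pairingCLM (Φ x) h := continuous_pairing hΦ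
  have key : pairingCLM (strongIntegral μ hf hΦ) = strongIntegral μ hf hc := by
    refine traceClass_hom_ext fun ξ η => ?_
    exact inner_strongIntegral_right μ hf hΦ η ξ
  exact congrArg (fun L => L h) key

/-- `T ↦ A T B` has a predual map, given on vector functionals by `B` and `A*`. -/
theorem pairing_mul_mul_traceVector (A T B : H →L[ℂ] H) (ξ η : H) :
    pairing H (A * T * B) (traceVector ξ η) = pairing H T (traceVector (B ξ) (star A η)) := by
  rw [pairing_traceVector, pairing_traceVector, ContinuousLinearMap.star_eq_adjoint,
    ContinuousLinearMap.adjoint_inner_left]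
  rfl

theorem norm_adPredual_le (U : H →L[ℂ] H) : ‖adPredual U‖ ≤ ‖U‖ * ‖U‖ := by
  refine ContinuousLinearMap.opNorm_le_bound _ (by positivity) fun h => ?_
  rw [← ClosedSpan.norm_incl]
  refine ContinuousLinearMap.opNorm_le_bound _ (by positivity) fun T => ?_
  have h1 : ClosedSpan.incl _ (adPredual U h) T = TraceClass.toDual h (U * T * star U) := rfl
  rw [h1]
  calc ‖TraceClass.toDual h (U * T * star U)‖ ≤ ‖h‖ * ‖U * T * star U‖ :=
        (TraceClass.toDual h).le_opNorm _
    _ ≤ ‖h‖ * (‖U‖ * ‖T‖ * ‖U‖) := by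
        gcongr
        refine (norm_mul_le _ _).trans ?_
        rw [norm_star]
        gcongr
        exact norm_mul_le _ _
    _ = ‖U‖ * ‖U‖ * ‖h‖ * ‖T‖ := by ring

theorem adPredual_traceVector (U : H →L[ℂ] H) (ξ η : H) :
    adPredual U (traceVector ξ η) = traceVector (star U ξ) (star U η) := by
  refine Subtype.ext ?_
  ext T
  change ⟪η, U (T (star U ξ))⟫_ℂ = ⟪star U η, T (star U ξ)⟫_ℂ
  rw [ContinuousLinearMap.star_eq_adjoint, ContinuousLinearMap.adjoint_inner_left]

theorem continuous_adPredual {U : X → H →L[ℂ] H}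
    (hU : ∀ ξ, Continuous fun x => star (U x) ξ) (h : TraceClass H) :
    Continuous fun x => adPredual (U x) h := by
  obtain ⟨C, hC⟩ := exists_norm_le_of_strongly_continuous hU
  have hb : ∀ x, ‖adPredual (U x)‖ ≤ C * C := fun x => by
    have hx : ‖U x‖ ≤ C := norm_star (U x) ▸ hC x
    exact (norm_adPredual_le _).trans
      (mul_le_mul hx hx (norm_nonneg _) ((norm_nonneg _).trans hx))
  refine continuous_of_continuous_traceVector hb (fun ξ η => ?_) h
  simp only [adPredual_traceVector]
  exact continuous_traceVector.comp ((hU ξ).prodMk (hU η))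

end Predual

/-! ### Translations of continuous functions and of `Lᵖ` functions -/

section Translations

variable {G : Type*} [Group G] [TopologicalSpace G] [IsTopologicalGroup G]

/-- Left translation of continuous functions, `t ↦ φ (s⁻¹ t)`. -/
def leftC (s : G) (φ : C(G, ℂ)) : C(G, ℂ) := φ.comp ⟨fun t => s⁻¹ * t, by fun_prop⟩

/-- Right translation of continuous functions, `s ↦ φ (s r)`. -/
def rightC (r : G) (φ : C(G, ℂ)) : C(G, ℂ) := φ.comp ⟨fun s => s * r, by fun_prop⟩

@[simp]
theorem leftC_apply (s t : G) (φ : C(G, ℂ)) : leftC s φ t = φ (s⁻¹ * t) := rfl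

@[simp]
theorem rightC_apply (r s : G) (φ : C(G, ℂ)) : rightC r φ s = φ (s * r) := rfl

theorem continuous_leftC (φ : C(G, ℂ)) : Continuous fun s : G => leftC s φ := by
  refine ContinuousMap.continuous_of_continuous_uncurry _ ?_
  change Continuous fun p : G × G => φ (p.1⁻¹ * p.2)
  fun_prop

theorem continuous_rightC (φ : C(G, ℂ)) : Continuous fun r : G => rightC r φ := by
  refine ContinuousMap.continuous_of_continuous_uncurry _ ?_
  change Continuous fun p : G × G => φ (p.2 * p.1)
  fun_prop

variable [CompactSpace G] [MeasurableSpace G] [BorelSpace G] (μ : Measure G) [μ.IsHaarMeasure]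

/-- Haar measure on a compact group is invariant under inversion. -/
theorem isInvInvariant_of_compact : μ.IsInvInvariant := by
  have : μ.IsMulRightInvariant := ⟨fun r => (measurePreserving_mul_right_of_compact μ r).map_eq⟩
  have h := Measure.isMulInvariant_eq_smul_of_compactSpace μ.inv μ
  have h1 := congrArg (fun ν : Measure G => ν Set.univ) h
  simp only [Measure.inv_apply, Set.inv_univ, Measure.smul_apply] at h1
  have h0 : μ Set.univ ≠ 0 := NeZero.ne _
  have ht : μ Set.univ ≠ ∞ := measure_ne_top _ _
  have hc : Measure.haarScalarFactor μ.inv μ = 1 := by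
    rw [ENNReal.smul_def, smul_eq_mul] at h1
    have := (ENNReal.mul_eq_right h0 ht).1 h1.symm
    exact_mod_cast this
  rw [hc, one_smul] at h
  exact ⟨h⟩

theorem integral_mul_inv_eq_self (k : G → ℂ) (x : G) :
    ∫ r, k (x * r⁻¹) ∂μ = ∫ y, k y ∂μ := by
  have := isInvInvariant_of_compact μ
  rw [integral_inv_eq_self (fun r => k (x * r)) μ, integral_mul_left_eq_self]

section Lp

variable (p : ℝ≥0∞) [Fact (1 ≤ p)]

theorem leftTranslation_toLp (s : G) (φ : C(G, ℂ)) :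
    leftTranslation μ p s (φ.toLp p μ ℂ) = (leftC s φ).toLp p μ ℂ := by
  refine Lp.ext ?_
  refine (Lp.coeFn_compMeasurePreserving _ (measurePreserving_mul_left μ s⁻¹)).trans ?_
  refine ((measurePreserving_mul_left μ s⁻¹).quasiMeasurePreserving.ae_eq_comp
    (ContinuousMap.coeFn_toLp μ (𝕜 := ℂ) φ)).trans ?_
  exact (ContinuousMap.coeFn_toLp μ (𝕜 := ℂ) (leftC s φ)).symm

theorem rightRegular_toLp (r : G) (φ : C(G, ℂ)) :
    rightRegular μ r (φ.toLp 2 μ ℂ) = (rightC r φ).toLp 2 μ ℂ := by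
  refine Lp.ext ?_
  refine (Lp.coeFn_compMeasurePreserving _ (measurePreserving_mul_right_of_compact μ r)).trans ?_
  refine ((measurePreserving_mul_right_of_compact μ r).quasiMeasurePreserving.ae_eq_comp
    (ContinuousMap.coeFn_toLp μ (𝕜 := ℂ) φ)).trans ?_
  exact (ContinuousMap.coeFn_toLp μ (𝕜 := ℂ) (rightC r φ)).symm

variable {p}

theorem continuous_leftTranslation (hp : p ≠ ∞) (f : Lp ℂ p μ) :
    Continuous fun s : G => leftTranslation μ p s f := by
  refine Continuous.compMeasurePreservingLp (f := fun _ => f)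
    (g := fun s : G => ⟨fun t => s⁻¹ * t, by fun_prop⟩) continuous_const ?_
    (fun s => measurePreserving_mul_left μ s⁻¹) hp
  refine ContinuousMap.continuous_of_continuous_uncurry _ ?_
  change Continuous fun q : G × G => q.1⁻¹ * q.2
  fun_prop

theorem continuous_rightRegular (f : Lp ℂ 2 μ) : Continuous fun r : G => rightRegular μ r f := by
  refine Continuous.compMeasurePreservingLp (f := fun _ => f)
    (g := fun r : G => ⟨fun s => s * r, by fun_prop⟩) continuous_const ?_
    (fun r => measurePreserving_mul_right_of_compact μ r) (by simp)
  refine ContinuousMap.continuous_of_continuous_uncurry _ ?_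
  change Continuous fun q : G × G => q.2 * q.1
  fun_prop

theorem denseRange_toLp (hp : p ≠ ∞) : DenseRange fun φ : C(G, ℂ) => φ.toLp p μ ℂ :=
  ContinuousMap.toLp_denseRange ℂ μ ℂ hp

variable {μ} in
/-- Bounded operators on `Lᵖ(G)`, `p < ∞`, are determined by the continuous functions. -/
theorem clm_ext_toLp (hp : p ≠ ∞) {F : Type*} [NormedAddCommGroup F] [NormedSpace ℂ F]
    {A B : Lp ℂ p μ →L[ℂ] F} (h : ∀ φ : C(G, ℂ), A (φ.toLp p μ ℂ) = B (φ.toLp p μ ℂ)) : A = B :=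
  DFunLike.coe_injective
    ((denseRange_toLp μ hp).equalizer A.continuous B.continuous (funext h))

end Lp

theorem leftRegular_one : leftRegular μ (1 : G) = 1 := by
  refine clm_ext_toLp (by simp) fun φ => ?_
  rw [leftTranslation_toLp, one_apply_eq_self]
  congr 1
  ext t
  simp

theorem leftRegular_mul (s t : G) : leftRegular μ (s * t) = leftRegular μ s * leftRegular μ t := by
  refine clm_ext_toLp (by simp) fun φ => ?_
  simp only [mul_apply_eq_comp, leftTranslation_toLp]
  congr 1
  ext x
  simp [mul_assoc]

theorem rightRegular_one : rightRegular μ (1 : G) = 1 := by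
  refine clm_ext_toLp (by simp) fun φ => ?_
  rw [rightRegular_toLp, one_apply_eq_self]
  congr 1
  ext t
  simp

theorem rightRegular_mul (r t : G) :
    rightRegular μ (r * t) = rightRegular μ r * rightRegular μ t := by
  refine clm_ext_toLp (by simp) fun φ => ?_
  simp only [mul_apply_eq_comp, rightRegular_toLp]
  congr 1
  ext x
  simp [mul_assoc]

theorem leftRegular_mul_rightRegular (s r : G) :
    leftRegular μ s * rightRegular μ r = rightRegular μ r * leftRegular μ s := by
  refine clm_ext_toLp (by simp) fun φ => ?_
  simp only [mul_apply_eq_comp, rightRegular_toLp, leftTranslation_toLp]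
  congr 1
  ext x
  simp [mul_assoc]

theorem inner_leftRegular_leftRegular (s : G) (x y : Lp ℂ 2 μ) :
    ⟪leftRegular μ s x, leftRegular μ s y⟫_ℂ = ⟪x, y⟫_ℂ :=
  LinearIsometry.inner_map_map _ x y

theorem inner_rightRegular_rightRegular (r : G) (x y : Lp ℂ 2 μ) :
    ⟪rightRegular μ r x, rightRegular μ r y⟫_ℂ = ⟪x, y⟫_ℂ :=
  LinearIsometry.inner_map_map _ x y

theorem star_leftRegular (s : G) : star (leftRegular μ s) = leftRegular μ s⁻¹ := by
  refine ((ContinuousLinearMap.eq_adjoint_iff _ _).2 fun x y => ?_).symm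
  rw [← inner_leftRegular_leftRegular μ s, ← mul_apply_eq_comp, ← leftRegular_mul,
    mul_inv_cancel, leftRegular_one, one_apply_eq_self]

theorem star_rightRegular (r : G) : star (rightRegular μ r) = rightRegular μ r⁻¹ := by
  refine ((ContinuousLinearMap.eq_adjoint_iff _ _).2 fun x y => ?_).symm
  rw [← inner_rightRegular_rightRegular μ r, ← mul_apply_eq_comp, ← rightRegular_mul,
    mul_inv_cancel, rightRegular_one, one_apply_eq_self]

/-! ### Convolution as an average of left or of right translates -/

/-- The substitution `r = y⁻¹ x` in the convolution of continuous functions: the average of left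
translates of `ψ` with weight `φ` is the average of right translates of `φ` with weight `ψ`. -/
theorem integral_smul_leftC_eq (φ ψ : C(G, ℂ)) :
    ∫ y, φ y • leftC y ψ ∂μ = ∫ r, ψ r • rightC r⁻¹ φ ∂μ := by
  have h1 : Continuous fun y => φ y • leftC y ψ := φ.continuous.smul (continuous_leftC ψ)
  have h2 : Continuous fun r => ψ r • rightC r⁻¹ φ :=
    ψ.continuous.smul ((continuous_rightC φ).comp continuous_inv)
  ext x
  rw [ContinuousMap.integral_apply (integrable_of_continuous h1),
    ContinuousMap.integral_apply (integrable_of_continuous h2),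
    ← integral_mul_inv_eq_self μ _ x]
  refine integral_congr_ae (.of_forall fun r => ?_)
  simp [mul_comm]

theorem integral_smul_leftTranslation_toLp (p : ℝ≥0∞) [Fact (1 ≤ p)] (φ ψ : C(G, ℂ)) :
    ∫ y, φ y • leftTranslation μ p y (ψ.toLp p μ ℂ) ∂μ =
      ∫ r, ψ r • (rightC r⁻¹ φ).toLp p μ ℂ ∂μ := by
  have h1 : Continuous fun y => φ y • leftC y ψ := φ.continuous.smul (continuous_leftC ψ)
  have h2 : Continuous fun r => ψ r • rightC r⁻¹ φ :=
    ψ.continuous.smul ((continuous_rightC φ).comp continuous_inv)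
  simp only [leftTranslation_toLp, ← map_smul]
  rw [ContinuousLinearMap.integral_comp_comm _ (integrable_of_continuous h1),
    ContinuousLinearMap.integral_comp_comm _ (integrable_of_continuous h2),
    integral_smul_leftC_eq]

/-- Left convolution by a continuous function on `L²(G)`, the operator `∫ g(s) λ_s ds`. -/
def leftConvolution (g : C(G, ℂ)) : Lp ℂ 2 μ →L[ℂ] Lp ℂ 2 μ :=
  strongIntegral μ (integrable_of_continuous g.continuous)
    (continuous_leftTranslation μ (p := 2) (by simp))

theorem continuous_rightRegular_inv (f : Lp ℂ 2 μ) :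
    Continuous fun r : G => rightRegular μ r⁻¹ f :=
  (continuous_rightRegular μ f).comp continuous_inv

theorem leftConvolution_toLp (g ξ : C(G, ℂ)) :
    leftConvolution μ g (ξ.toLp 2 μ ℂ) =
      strongIntegral μ (integrable_of_continuous ξ.continuous) (continuous_rightRegular_inv μ)
        (g.toLp 2 μ ℂ) := by
  rw [strongIntegral_apply]
  simp only [rightRegular_toLp]
  exact integral_smul_leftTranslation_toLp μ 2 g ξ

theorem continuous_toLp_rightC_inv (p : ℝ≥0∞) [Fact (1 ≤ p)] (φ : C(G, ℂ)) :
    Continuous fun r : G => (rightC r⁻¹ φ).toLp p μ ℂ :=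
  (ContinuousMap.toLp p μ ℂ).continuous.comp ((continuous_rightC φ).comp continuous_inv)

/-- Convolution of a continuous function with an `L¹` function as an average of right
translates. -/
theorem convolution_toLp (φ : C(G, ℂ)) (f : Lp ℂ 1 μ) :
    convolution μ (φ.toLp 1 μ ℂ) f = ∫ r, f r • (rightC r⁻¹ φ).toLp 1 μ ℂ ∂μ := by
  have h1 : convolution μ (φ.toLp 1 μ ℂ) f = ∫ y, φ y • leftTranslation μ 1 y f ∂μ := by
    refine integral_congr_ae ?_
    filter_upwards [ContinuousMap.coeFn_toLp μ (𝕜 := ℂ) (p := 1) φ] with y hy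
    rw [hy]
  have key : strongIntegral μ (integrable_of_continuous φ.continuous)
      (continuous_leftTranslation μ (p := 1) (by simp)) =
        weightedIntegral μ _ (continuous_toLp_rightC_inv μ 1 φ) := by
    refine clm_ext_toLp (by simp) fun ψ => ?_
    refine (integral_smul_leftTranslation_toLp μ 1 φ ψ).trans ?_
    rw [weightedIntegral_apply]
    refine integral_congr_ae ?_
    filter_upwards [ContinuousMap.coeFn_toLp μ (𝕜 := ℂ) (p := 1) ψ] with y hy
    rw [hy]
  rw [h1]
  exact congrArg (fun L => L f) key

/-! ### Multiplication operators -/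

theorem multiplicationOperator_coeFn (a : Lp ℂ ∞ μ) (f : Lp ℂ 2 μ) :
    multiplicationOperator a f =ᵐ[μ] fun x => a x * f x :=
  ContinuousLinearMap.coeFn_holder _ a f

theorem multiplicationOperator_toLp (a φ : C(G, ℂ)) :
    multiplicationOperator (a.toLp ∞ μ ℂ) (φ.toLp 2 μ ℂ) = (a * φ).toLp 2 μ ℂ := by
  refine Lp.ext ?_
  filter_upwards [multiplicationOperator_coeFn μ (a.toLp ∞ μ ℂ) (φ.toLp 2 μ ℂ),
    ContinuousMap.coeFn_toLp μ (𝕜 := ℂ) (p := ∞) a, ContinuousMap.coeFn_toLp μ (𝕜 := ℂ) (p := 2) φ,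
    ContinuousMap.coeFn_toLp μ (𝕜 := ℂ) (p := 2) (a * φ)] with x h1 h2 h3 h4
  rw [h1, h2, h3, h4, ContinuousMap.mul_apply]

/-- The matrix coefficients of `M_a` at continuous vectors, in terms of the pairing of `L¹` and
`L^∞`. -/
theorem inner_multiplicationOperator_toLp (a : Lp ℂ ∞ μ) (η ξ : C(G, ℂ)) :
    ⟪η.toLp 2 μ ℂ, multiplicationOperator a (ξ.toLp 2 μ ℂ)⟫_ℂ =
      ContinuousLinearMap.lpPairing μ 1 ∞ (ContinuousLinearMap.mul ℂ ℂ)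
        ((star η * ξ).toLp 1 μ ℂ) a := by
  rw [ContinuousLinearMap.lpPairing_eq_integral, L2.inner_def]
  refine integral_congr_ae ?_
  filter_upwards [multiplicationOperator_coeFn μ a (ξ.toLp 2 μ ℂ),
    ContinuousMap.coeFn_toLp μ (𝕜 := ℂ) (p := 2) η, ContinuousMap.coeFn_toLp μ (𝕜 := ℂ) (p := 2) ξ,
    ContinuousMap.coeFn_toLp μ (𝕜 := ℂ) (p := 1) (star η * ξ)] with x h1 h2 h3 h4
  simp only [h1, h2, h3, h4, RCLike.inner_apply, ContinuousMap.mul_apply, ContinuousMap.star_apply,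
    ContinuousLinearMap.mul_apply', RCLike.star_def]
  ring

/-! ### The action of `L¹(G)` on the predual -/

variable {μ} in
theorem mem_annihilator_iff (J : Submodule ℂ (Lp ℂ 1 μ)) (a : Lp ℂ ∞ μ) :
    a ∈ annihilator J ↔ ∀ f ∈ J,
      ContinuousLinearMap.lpPairing μ 1 ∞ (ContinuousLinearMap.mul ℂ ℂ) f a = 0 := by
  simp only [ContinuousLinearMap.lpPairing_eq_integral]
  rfl

theorem thetaPoint_traceVector (r : G) (ξ η : Lp ℂ 2 μ) :
    thetaPoint μ r (traceVector ξ η) =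
      traceVector (rightRegular μ r⁻¹ ξ) (rightRegular μ r⁻¹ η) := by
  rw [thetaPoint, adPredual_traceVector, star_rightRegular]

theorem pairing_thetaPoint (T : Lp ℂ 2 μ →L[ℂ] Lp ℂ 2 μ) (r : G) (h : TraceClass (Lp ℂ 2 μ)) :
    pairing _ T (thetaPoint μ r h) =
      pairing _ (rightRegular μ r * T * rightRegular μ r⁻¹) h := by
  rw [← star_rightRegular]
  rfl

/-- The orbits of the action of `G` on the predual are norm continuous, so the Bochner integrals
that define `θ(f)` converge. -/
theorem continuous_thetaPoint (h : TraceClass (Lp ℂ 2 μ)) :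
    Continuous fun r : G => thetaPoint μ r h := by
  refine continuous_adPredual (U := fun r => rightRegular μ r) (fun ξ => ?_) h
  simp only [star_rightRegular]
  exact continuous_rightRegular_inv μ ξ

variable {μ} in
/-- `θ(f)` as a bounded operator on the predual. -/
def thetaCLM (f : Lp ℂ 1 μ) : TraceClass (Lp ℂ 2 μ) →L[ℂ] TraceClass (Lp ℂ 2 μ) :=
  strongIntegral μ (L1.integrable_coeFn f) (continuous_thetaPoint μ)

variable {μ} in
theorem pairing_theta (T : Lp ℂ 2 μ →L[ℂ] Lp ℂ 2 μ) (f : Lp ℂ 1 μ) (h : TraceClass (Lp ℂ 2 μ)) :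
    pairing _ T (theta f h) = ∫ r, f r * pairing _ T (thetaPoint μ r h) ∂μ := by
  have h1 := ContinuousLinearMap.integral_comp_comm (pairingCLM T)
    (integrable_smul_of_continuous (L1.integrable_coeFn f) (continuous_thetaPoint μ h))
  simp only [map_smul, smul_eq_mul] at h1
  exact h1.symm

end Translations

section Bimodule

variable {G : Type*} [Group G] [TopologicalSpace G] [IsTopologicalGroup G]
  [CompactSpace G] [MeasurableSpace G] [BorelSpace G] (μ : Measure G) [μ.IsHaarMeasure]

/-! ### The bimodule lies in the annihilator of the range -/

/-- `VN(G)` commutes with right translations: for fixed `ξ, η` the equation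
`(A ρ_r ξ, η) = (ρ_r A ξ, η)` is the vanishing of `A` on one element of the predual. -/
theorem commute_rightRegular_of_mem_groupVN {A : Lp ℂ 2 μ →L[ℂ] Lp ℂ 2 μ} (hA : A ∈ groupVN μ)
    (r : G) : Commute A (rightRegular μ r) := by
  have key : ∀ ξ η : Lp ℂ 2 μ, pairing _ A
      (traceVector (rightRegular μ r ξ) η - traceVector ξ (star (rightRegular μ r) η)) = 0 := by
    intro ξ η
    refine (mem_weakClosure_iff_forall _ _ A).1 hA _ fun v hv => ?_
    have hcomm : v * rightRegular μ r = rightRegular μ r * v := by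
      induction hv using Submodule.span_induction with
      | mem x hx =>
        obtain ⟨s, rfl⟩ := hx
        exact leftRegular_mul_rightRegular μ s r
      | zero => simp
      | add x y _ _ hx hy => rw [add_mul, mul_add, hx, hy]
      | smul c x _ hx => rw [smul_mul_assoc, mul_smul_comm, hx]
    have hadj : pairing _ v
        (traceVector (rightRegular μ r ξ) η - traceVector ξ (star (rightRegular μ r) η)) =
          ⟪η, (v * rightRegular μ r - rightRegular μ r * v) ξ⟫_ℂ := by
      rw [map_sub, pairing_traceVector, pairing_traceVector, ContinuousLinearMap.star_eq_adjoint,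
        ContinuousLinearMap.adjoint_inner_left, ← inner_sub_right]
      rfl
    rw [hadj, hcomm, sub_self, zero_apply, inner_zero_right]
  refine ContinuousLinearMap.ext fun ξ => ext_inner_left ℂ fun η => ?_
  have h := key ξ η
  rw [map_sub, pairing_traceVector, pairing_traceVector, ContinuousLinearMap.star_eq_adjoint,
    ContinuousLinearMap.adjoint_inner_left] at h
  exact sub_eq_zero.1 h

variable {μ}

/-- For `a ∈ J^⊥` the multiplication operator `M_a` kills the range of `θ(f)`, `f ∈ J`. On a vector
functional with continuous `ξ, η` the pairing is that of `a` with `φ * f ∈ J`, where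
`φ = conj η * ξ`. -/
theorem pairing_multiplicationOperator_theta {J : Submodule ℂ (Lp ℂ 1 μ)} (hJ : IsLeftIdeal J)
    {f : Lp ℂ 1 μ} (hf : f ∈ J) {a : Lp ℂ ∞ μ} (ha : a ∈ annihilator J)
    (h : TraceClass (Lp ℂ 2 μ)) : pairing _ (multiplicationOperator a) (theta f h) = 0 := by
  let Λ : Lp ℂ 1 μ →L[ℂ] ℂ :=
    (ContinuousLinearMap.lpPairing μ 1 ∞ (ContinuousLinearMap.mul ℂ ℂ)).flip a
  have hcont : ∀ ξ η : C(G, ℂ), pairing _ (multiplicationOperator a)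
      (theta f (traceVector (ξ.toLp 2 μ ℂ) (η.toLp 2 μ ℂ))) = 0 := by
    intro ξ η
    have h1 : Λ (convolution μ ((star η * ξ).toLp 1 μ ℂ) f) = 0 :=
      (mem_annihilator_iff J a).1 ha _ (hJ _ f hf)
    rw [convolution_toLp, ← ContinuousLinearMap.integral_comp_comm Λ
      (integrable_smul_of_continuous (L1.integrable_coeFn f) (continuous_toLp_rightC_inv μ 1 _))]
      at h1
    rw [pairing_theta, ← h1]
    refine integral_congr_ae (.of_forall fun r => ?_)
    simp only [map_smul, smul_eq_mul]
    congr 1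
    rw [thetaPoint_traceVector, pairing_traceVector, rightRegular_toLp, rightRegular_toLp,
      inner_multiplicationOperator_toLp]
    rfl
  have hzero : (pairingCLM (multiplicationOperator a)).comp (thetaCLM f) = 0 := by
    refine traceClass_hom_ext fun ξ η => ?_
    have hd : DenseRange fun φ : C(G, ℂ) => φ.toLp 2 μ ℂ := denseRange_toLp μ (by simp)
    have hc : Continuous fun p : Lp ℂ 2 μ × Lp ℂ 2 μ =>
        (pairingCLM (multiplicationOperator a)).comp (thetaCLM f) (traceVector p.1 p.2) :=
      (ContinuousLinearMap.continuous _).comp continuous_traceVector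
    have := (hd.prodMap hd).equalizer hc (continuous_const (y := (0 : ℂ)))
      (funext fun p => hcont p.1 p.2)
    exact congrFun this (ξ, η)
  exact congrArg (fun L => L h) hzero

theorem pairing_mul_multiplicationOperator_mul_theta {J : Submodule ℂ (Lp ℂ 1 μ)}
    (hJ : IsLeftIdeal J) {f : Lp ℂ 1 μ} (hf : f ∈ J) {a : Lp ℂ ∞ μ} (ha : a ∈ annihilator J)
    {A B : Lp ℂ 2 μ →L[ℂ] Lp ℂ 2 μ} (hA : A ∈ groupVN μ) (hB : B ∈ groupVN μ)
    (h : TraceClass (Lp ℂ 2 μ)) :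
    pairing _ (A * multiplicationOperator a * B) (theta f h) = 0 := by
  have hzero : (pairingCLM (A * multiplicationOperator a * B)).comp (thetaCLM f) = 0 := by
    refine traceClass_hom_ext fun ξ η => ?_
    have h1 := pairing_multiplicationOperator_theta hJ hf ha (traceVector (B ξ) (star A η))
    rw [pairing_theta] at h1
    change pairing _ (A * multiplicationOperator a * B) (theta f (traceVector ξ η)) = 0
    rw [pairing_theta, ← h1]
    refine integral_congr_ae (.of_forall fun r => ?_)
    beta_reduce
    congr 1
    -- `A` and `B` commute with `ρ_r`, so they may be moved from the operator to the functional
    rw [pairing_thetaPoint, pairing_thetaPoint, ← pairing_mul_mul_traceVector]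
    have hAr := (commute_rightRegular_of_mem_groupVN μ hA r).eq
    have hBr := (commute_rightRegular_of_mem_groupVN μ hB r⁻¹).eq
    have hop : rightRegular μ r * (A * multiplicationOperator a * B) * rightRegular μ r⁻¹ =
        A * (rightRegular μ r * multiplicationOperator a * rightRegular μ r⁻¹) * B := by
      calc _ = (rightRegular μ r * A) * multiplicationOperator a * (B * rightRegular μ r⁻¹) := by
            simp only [mul_assoc]
        _ = _ := by rw [← hAr, hBr]; simp only [mul_assoc]
    rw [hop]
  exact congrArg (fun L => L h) hzero

theorem bim_le_operatorAnnihilator {J : Submodule ℂ (Lp ℂ 1 μ)} (hJ : IsLeftIdeal J) :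
    Bim (annihilator J) ≤ operatorAnnihilator (Ran J) := by
  intro T hT k hk
  refine (mem_weakClosure_iff_forall _ _ T).1 hT k fun v hv => ?_
  induction hv using Submodule.span_induction with
  | mem S hS =>
    obtain ⟨A, hA, B, hB, a, ha, rfl⟩ := hS
    have hle : Ran J ≤
        LinearMap.ker (pairingCLM (A * multiplicationOperator a * B)).toLinearMap := by
      refine Submodule.topologicalClosure_minimal _ (Submodule.span_le.2 ?_)
        (ContinuousLinearMap.isClosed_ker _)
      rintro _ ⟨f, hf, h, rfl⟩
      exact pairing_mul_multiplicationOperator_mul_theta hJ hf ha hA hB h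
    exact hle hk
  | zero => simp
  | add x y _ _ hx hy => rw [map_add, LinearMap.add_apply, hx, hy, add_zero]
  | smul c x _ hx => rw [map_smul, LinearMap.smul_apply, hx, smul_zero]

/-! ### The annihilator of the range lies in the bimodule -/

/-- The coefficient function `r ↦ (ρ_r T ρ_r* u, v)` of an operator `T`. -/
def coefficient (T : Lp ℂ 2 μ →L[ℂ] Lp ℂ 2 μ) (u v : Lp ℂ 2 μ) : C(G, ℂ) where
  toFun r := ⟪rightRegular μ r⁻¹ v, T (rightRegular μ r⁻¹ u)⟫_ℂ
  continuous_toFun := (continuous_rightRegular_inv μ v).inner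
    (T.continuous.comp (continuous_rightRegular_inv μ u))

theorem coefficient_apply (T : Lp ℂ 2 μ →L[ℂ] Lp ℂ 2 μ) (u v : Lp ℂ 2 μ) (r : G) :
    coefficient T u v r = ⟪rightRegular μ r⁻¹ v, T (rightRegular μ r⁻¹ u)⟫_ℂ := rfl

/-- The integral of `f ∈ J` against the coefficient function is `⟨T, θ(f) ω⟩` for the vector
functional `ω` of `u, v`. -/
theorem coefficient_mem_annihilator {J : Submodule ℂ (Lp ℂ 1 μ)} {T : Lp ℂ 2 μ →L[ℂ] Lp ℂ 2 μ}
    (hT : T ∈ operatorAnnihilator (Ran J)) (u v : Lp ℂ 2 μ) :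
    (coefficient T u v).toLp ∞ μ ℂ ∈ annihilator J := by
  intro f hf
  have h1 : pairing _ T (theta f (traceVector u v)) = 0 :=
    hT _ (Submodule.le_topologicalClosure _ (Submodule.subset_span ⟨f, hf, _, rfl⟩))
  rw [pairing_theta] at h1
  rw [← h1]
  refine integral_congr_ae ?_
  filter_upwards [ContinuousMap.coeFn_toLp μ (𝕜 := ℂ) (p := ∞) (coefficient T u v)] with r hr
  rw [hr, thetaPoint_traceVector, pairing_traceVector, coefficient_apply]

theorem leftRegular_mem_groupVN (s : G) : leftRegular μ s ∈ groupVN μ :=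
  (mem_weakClosure_iff_forall _ _ _).2 fun _ hw => hw _ (Submodule.subset_span ⟨s, rfl⟩)

theorem continuous_coefficient_rightRegular (T : Lp ℂ 2 μ →L[ℂ] Lp ℂ 2 μ) (u v : Lp ℂ 2 μ) :
    Continuous fun s : G => coefficient T (rightRegular μ s u) v := by
  refine ContinuousMap.continuous_of_continuous_uncurry _ ?_
  change Continuous fun p : G × G =>
    ⟪rightRegular μ p.2⁻¹ v, T (rightRegular μ p.2⁻¹ (rightRegular μ p.1 u))⟫_ℂ
  simp only [← mul_apply_eq_comp, ← rightRegular_mul]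
  have h1 : Continuous fun p : G × G => rightRegular μ p.2⁻¹ v :=
    (continuous_rightRegular μ v).comp (by fun_prop)
  have h2 : Continuous fun p : G × G => rightRegular μ (p.2⁻¹ * p.1) u :=
    (continuous_rightRegular μ u).comp (by fun_prop)
  exact h1.inner (T.continuous.comp h2)

theorem continuous_coefficient_mul_leftRegular (T : Lp ℂ 2 μ →L[ℂ] Lp ℂ 2 μ) (u v ξ : Lp ℂ 2 μ) :
    Continuous fun s : G => (multiplicationOperator
      ((coefficient T (rightRegular μ s u) v).toLp ∞ μ ℂ) * leftRegular μ s) ξ := by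
  have h1 : Continuous fun s : G => multiplicationOperator
      ((coefficient T (rightRegular μ s u) v).toLp ∞ μ ℂ) :=
    ((ContinuousLinearMap.mul ℂ ℂ).holderL μ ∞ 2 2).continuous.comp
      ((ContinuousMap.toLp ∞ μ ℂ).continuous.comp (continuous_coefficient_rightRegular T u v))
  exact h1.clm_apply (continuous_leftTranslation μ (by simp) ξ)

/-- The operator `λ(g')* T λ(g)` has the continuous kernel `(x, y) ↦ (T ρ_y* g, ρ_x* g')`. Sorting
the kernel by the value `s` of `x y⁻¹` writes the operator as the integral of the operators
`M_{a_s} λ_s`, where `a_s` is the coefficient function of `T` at `ρ_s g` and `g'`. -/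
theorem star_leftConvolution_mul_mul_leftConvolution (T : Lp ℂ 2 μ →L[ℂ] Lp ℂ 2 μ)
    (g g' : C(G, ℂ)) :
    star (leftConvolution μ g') * T * leftConvolution μ g =
      strongIntegral μ (integrable_const (1 : ℂ))
        (continuous_coefficient_mul_leftRegular T (g.toLp 2 μ ℂ) (g'.toLp 2 μ ℂ)) := by
  refine clm_ext_toLp (by simp) fun ξ => ?_
  have hd : DenseRange fun φ : C(G, ℂ) => φ.toLp 2 μ ℂ := denseRange_toLp μ (by simp)
  refine Dense.eq_of_inner_right (𝕜 := ℂ) hd ?_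
  rintro _ ⟨η, rfl⟩
  let k : G → G → ℂ := fun s x =>
    coefficient T (rightRegular μ s (g.toLp 2 μ ℂ)) (g'.toLp 2 μ ℂ) x * ξ (s⁻¹ * x) * star (η x)
  have hk : Continuous (Function.uncurry k) := by
    have h1 : Continuous fun p : G × G =>
        coefficient T (rightRegular μ p.1 (g.toLp 2 μ ℂ)) (g'.toLp 2 μ ℂ) p.2 :=
      ContinuousMap.continuous_uncurry_of_continuous
        ⟨_, continuous_coefficient_rightRegular T (g.toLp 2 μ ℂ) (g'.toLp 2 μ ℂ)⟩
    change Continuous fun p : G × G =>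
      coefficient T (rightRegular μ p.1 (g.toLp 2 μ ℂ)) (g'.toLp 2 μ ℂ) p.2 *
        ξ (p.1⁻¹ * p.2) * star (η p.2)
    fun_prop
  have hr : ⟪η.toLp 2 μ ℂ, strongIntegral μ (integrable_const (1 : ℂ))
      (continuous_coefficient_mul_leftRegular T (g.toLp 2 μ ℂ) (g'.toLp 2 μ ℂ))
        (ξ.toLp 2 μ ℂ)⟫_ℂ = ∫ s, ∫ x, k s x ∂μ ∂μ := by
    rw [inner_strongIntegral_right]
    refine integral_congr_ae (.of_forall fun s => ?_)
    simp only [one_mul, mul_apply_eq_comp, leftTranslation_toLp, multiplicationOperator_toLp,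
      ContinuousMap.inner_toLp]
    rfl
  have hl : ⟪η.toLp 2 μ ℂ, (star (leftConvolution μ g') * T * leftConvolution μ g)
      (ξ.toLp 2 μ ℂ)⟫_ℂ = ∫ x, ∫ s, k s x ∂μ ∂μ := by
    rw [mul_assoc, mul_apply_eq_comp, ContinuousLinearMap.star_eq_adjoint,
      ContinuousLinearMap.adjoint_inner_right, leftConvolution_toLp, inner_strongIntegral_left]
    refine integral_congr_ae (.of_forall fun x => ?_)
    beta_reduce
    rw [mul_apply_eq_comp, ← ContinuousLinearMap.adjoint_inner_left, leftConvolution_toLp,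
      inner_strongIntegral_right, ← integral_const_mul,
      -- the substitution `s = x y⁻¹`
      ← integral_mul_inv_eq_self μ (fun s => k s x) x]
    refine integral_congr_ae (.of_forall fun y => ?_)
    have hρ : rightRegular μ x⁻¹ (rightRegular μ (x * y⁻¹) (g.toLp 2 μ ℂ)) =
        rightRegular μ y⁻¹ (g.toLp 2 μ ℂ) := by
      rw [← mul_apply_eq_comp, ← rightRegular_mul, inv_mul_cancel_left]
    simp only [k, coefficient_apply, hρ, ContinuousLinearMap.adjoint_inner_left, mul_inv_rev,
      inv_inv, inv_mul_cancel_right]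
    ring
  rw [hl, hr]
  exact (integral_integral_swap_of_hasCompactSupport hk (HasCompactSupport.of_compactSpace _)).symm

theorem continuous_leftRegular_inv (ξ : Lp ℂ 2 μ) :
    Continuous fun s : G => leftRegular μ s⁻¹ ξ :=
  (continuous_leftTranslation μ (by simp) ξ).comp continuous_inv

theorem star_leftConvolution (g : C(G, ℂ)) :
    star (leftConvolution μ g) =
      strongIntegral μ (integrable_of_continuous (star g).continuous)
        continuous_leftRegular_inv := by
  refine ((ContinuousLinearMap.eq_adjoint_iff _ _).2 fun x y => ?_).symm
  rw [inner_strongIntegral_left, leftConvolution, inner_strongIntegral_right]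
  refine integral_congr_ae (.of_forall fun s => ?_)
  simp only [ContinuousMap.star_apply, star_star]
  rw [← star_leftRegular, ContinuousLinearMap.star_eq_adjoint,
    ContinuousLinearMap.adjoint_inner_left]

/-- A continuous function orthogonal to all continuous functions, hence to its own conjugate,
vanishes. -/
theorem eq_zero_of_integral_mul_eq_zero {F : G → ℂ} (hF : Continuous F)
    (h : ∀ g : C(G, ℂ), ∫ s, g s * F s ∂μ = 0) : F = 0 := by
  have h1 := h (star ⟨F, hF⟩)
  have h2 : ∀ s, (star (⟨F, hF⟩ : C(G, ℂ))) s * F s = ((‖F s‖ ^ 2 : ℝ) : ℂ) := fun s => by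
    simp [Complex.conj_mul']
  simp only [h2] at h1
  rw [integral_complex_ofReal, Complex.ofReal_eq_zero] at h1
  have hc : Continuous fun s => ‖F s‖ ^ 2 := by fun_prop
  rw [integral_eq_zero_iff_of_nonneg (fun s => by positivity) (integrable_of_continuous hc)] at h1
  funext s
  have h3 : ‖F s‖ ^ 2 = 0 := congrFun ((hc.ae_eq_iff_eq μ continuous_zero).1 h1) s
  simpa using h3

/-- The operators `λ(g)` with continuous `g` detect `T` from the right: `s ↦ ⟨T λ_s, h⟩` is a
continuous function whose value at the identity is `⟨T, h⟩`. -/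
theorem pairing_eq_zero_of_mul_leftConvolution (T : Lp ℂ 2 μ →L[ℂ] Lp ℂ 2 μ)
    (h : TraceClass (Lp ℂ 2 μ)) (hT : ∀ g, pairing _ (T * leftConvolution μ g) h = 0) :
    pairing _ T h = 0 := by
  have hc : ∀ ξ, Continuous fun s : G => (T * leftRegular μ s) ξ := fun ξ =>
    T.continuous.comp (continuous_leftTranslation μ (by simp) ξ)
  have hF := eq_zero_of_integral_mul_eq_zero (μ := μ) (continuous_pairing hc h) fun g => by
    rw [← pairing_strongIntegral μ (integrable_of_continuous g.continuous) hc, ← hT g]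
    exact congrArg (fun S => pairing _ S h) (clm_comp_strongIntegral μ T _ _).symm
  simpa [leftRegular_one] using congrFun hF 1

/-- The operators `λ(g)*` with continuous `g` detect `T` from the left. -/
theorem pairing_eq_zero_of_star_leftConvolution_mul (T : Lp ℂ 2 μ →L[ℂ] Lp ℂ 2 μ)
    (h : TraceClass (Lp ℂ 2 μ)) (hT : ∀ g, pairing _ (star (leftConvolution μ g) * T) h = 0) :
    pairing _ T h = 0 := by
  have hc : ∀ ξ, Continuous fun s : G => (leftRegular μ s⁻¹ * T) ξ := fun ξ =>
    continuous_leftRegular_inv (T ξ)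
  have hF := eq_zero_of_integral_mul_eq_zero (μ := μ) (continuous_pairing hc h) fun g => by
    rw [← pairing_strongIntegral μ (integrable_of_continuous g.continuous) hc, ← hT (star g),
      star_leftConvolution]
    simp only [star_star]
    rfl
  simpa [leftRegular_one] using congrFun hF 1

theorem mem_bim_of_mem_operatorAnnihilator {J : Submodule ℂ (Lp ℂ 1 μ)}
    {T : Lp ℂ 2 μ →L[ℂ] Lp ℂ 2 μ} (hT : T ∈ operatorAnnihilator (Ran J)) :
    T ∈ Bim (annihilator J) := by
  refine (mem_weakClosure_iff_forall _ _ T).2 fun h hh => ?_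
  have h1 : ∀ g g' : C(G, ℂ),
      pairing _ (star (leftConvolution μ g') * T * leftConvolution μ g) h = 0 := by
    intro g g'
    rw [star_leftConvolution_mul_mul_leftConvolution, pairing_strongIntegral]
    refine integral_eq_zero_of_ae (.of_forall fun s => ?_)
    have hmem := hh (1 * multiplicationOperator
      ((coefficient T (rightRegular μ s (g.toLp 2 μ ℂ)) (g'.toLp 2 μ ℂ)).toLp ∞ μ ℂ) *
        leftRegular μ s) (Submodule.subset_span ⟨1, ?_, _, leftRegular_mem_groupVN s, _,
          coefficient_mem_annihilator hT _ _, rfl⟩)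
    · rw [one_mul] at hmem
      simp [hmem]
    · exact leftRegular_one μ ▸ leftRegular_mem_groupVN (1 : G)
  refine pairing_eq_zero_of_mul_leftConvolution T h fun g => ?_
  refine pairing_eq_zero_of_star_leftConvolution_mul _ h fun g' => ?_
  rw [← mul_assoc]
  exact h1 g g'

end Bimodule

end LeftIdealBimodule

end

theorem mainTheorem1 {G : Type*} [Group G] [TopologicalSpace G] [IsTopologicalGroup G]
    [CompactSpace G] [T2Space G] [MeasurableSpace G] [BorelSpace G]
    (μ : MeasureTheory.Measure G) [μ.IsHaarMeasure]
    (J : Submodule ℂ (MeasureTheory.Lp ℂ 1 μ)) (hJclosed : IsClosed (J : Set (MeasureTheory.Lp ℂ 1 μ)))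
    (hJ : LeftIdealBimodule.IsLeftIdeal J) :
    LeftIdealBimodule.operatorAnnihilator (LeftIdealBimodule.Ran J) =
      LeftIdealBimodule.Bim (LeftIdealBimodule.annihilator J) :=
  le_antisymm (fun _ => LeftIdealBimodule.mem_bim_of_mem_operatorAnnihilator)
    (LeftIdealBimodule.bim_le_operatorAnnihilator hJ)
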